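/- **Setting.** Let $\Bbbk$ be a field and let $P$ be a finite poset. Let $\widehat P=P\cup\{\hat 0,\hat 1\}$ be $P$ with a new minimum $\hat 0$ and a new maximum $\hat 1$, and let $\mathcal H$ be the Hasse diagram of $\widehat P$, with $d+1$ vertices, $n$ edges and edge set $E$; orient every edge $e=\{p,q\}$, where $q$ covers $p$, from $p$ to $q$. For an abelian group $A$ and $x\in A^{\widehat P\setminus\{\hat 1\}}$ put $x_{\hat 1}=0$ and $\sigma_e(x)=x_p-x_q$ for each such edge $e$. The Hibi ring $\Bbbk[P]$ is the $\Bbbk$-subalgebra of the Laurent polynomial ring $L=\Bbbk[t_p^{\pm1}:p\in\widehat P\setminus\{\hat 1\}]$ generated by the monomials $t_{\hat 0}\prod_{p\in I}t_p$, where $I$ runs over all poset ideals (down-closed subsets) of $P$. For $a\in\mathbb Z^{E}$ the divisorial ideal $T(a)\subset L$ is the $\Bbbk[P]$-module generated by the Laurent monomials $t^x$, $x\in\mathbb Z^{\widehat P\setminus\{\hat 1\}}$, with $\sigma_e(x)\ge a_e$ for all $e\in E$. It is called conic if it equals $T(\lceil\sigma(x)\rceil)$ for some $x\in\mathbb R^{\widehat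 P\setminus\{\hat 1\}}$, where $\lceil\sigma(x)\rceil=(\lceil\sigma_e(x)\rceil)_{e\in E}$. For a cycle $C$ of $\mathcal H$, traversed in one of its two directions, let $v(C)^{(e)}=1$ if $C$ traverses $e$ along its orientation, $-1$ if against it, and $0$ if $e\notin C$; let $\mathrm{supp}^{\pm}(C)$ be the set of edges $e$ with $\pm v(C)^{(e)}>0$. A circuit is a cycle without chords. Fix a spanning tree of $\mathcal H$ and let $e_{d+1},\dots,e_n$ be the edges outside it. Let $$\mathcal C(P)=\Big\{z\in\mathbb R^{n-d}: -|\mathrm{supp}^-(C)|+1\le\sum_{i=1}^{n-d}v(C)^{(e_{d+i})}z_i\le|\mathrm{supp}^+(C)|-1\ \text{ for all circuits } C \text{ of } \mathcal H\Big\}.$$ For $z\in\mathbb Z^{n-d}$ let $T_z=T(a)$, where $a_{e_{d+i}}=z_i$ for $1\le i\le n-d$ and $a_e=0$ for the edges $e$ of the tree. **Theorem.** There are exactly $n-d$ edges outside the spanning tree, and $\mathcal C(P)$ is bounded (so it is a polytope). The map $z\mapsto[T_z]$ is a bijection from $\mathbb Z^{n-d}$ onto the set of isomorphism classes, as $\Bbbk[P]$-modules,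 of the divisorial ideals $T(a)$, $a\in\mathbb Z^{E}$. It restricts to a bijection from $\mathcal C(P)\cap\mathbb Z^{n-d}$ onto the set of isomorphism classes of conic divisorial ideals of $\Bbbk[P]$. -/

import Mathlib

universe u v

noncomputable section

namespace HibiConic

/-- `P` with a new minimal element and a new maximal element adjoined. -/
abbrev Hat (P : Type v) : Type v := WithTop (WithBot P)

/-- The edges of the Hasse diagram of `Hat P`: an edge joining `p` to an element `q` that covers `p`
is recorded as the pair `(p, q)`, that is, oriented from `p` to `q`. -/
abbrev HEdge (P : Type v) [PartialOrder P] : Type v :=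
  {e : Hat P × Hat P // e.1 ⋖ e.2}

instance (P : Type v) [PartialOrder P] [Finite P] : Finite (HEdge P) :=
  haveI : Finite (Hat P) := inferInstanceAs (Finite (Option (Option P)))
  inferInstance

/-- Extend a vector indexed by `Hat P` without its maximal element by the value `0` there. -/
def extendTop {P : Type v} {A : Type*} [Zero A] (x : WithBot P → A) : Hat P → A :=
  WithTop.recTopCoe 0 x

/-- The linear map `σ_P`, with components `x_p - x_q` for `q` different from the maximal element
and `x_p` for `q` the maximal element, over all edges `p ⋖ q`. -/
def sigma {P : Type v} [PartialOrder P] {A : Type*} [AddGroup A] (x : WithBot P → A) :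
    HEdge P → A :=
  fun e => extendTop x e.1.1 - extendTop x e.1.2

section Ring

variable (k : Type u) [Field k] (P : Type v) [PartialOrder P]

/-- Laurent polynomials over `k` in variables indexed by `P` and one more variable,
indexed by `⊥`. -/
abbrev Laurent : Type (max u v) := AddMonoidAlgebra k (WithBot P → ℤ)

open scoped Classical in
variable {P} in
/-- The exponent vector of the monomial `t_⊥ * ∏ p ∈ I, t_p`. -/
def idealExponent (I : LowerSet P) : WithBot P → ℤ :=
  WithBot.recBotCoe 1 (fun p => if p ∈ I then 1 else 0)

/-- The Hibi ring `k[P]`, generated by the monomials `t_⊥ * ∏ p ∈ I, t_p` for the poset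
ideals `I` of `P`. -/
def hibiRing : Subalgebra k (Laurent k P) :=
  Algebra.adjoin k (Set.range fun I : LowerSet P => AddMonoidAlgebra.single (idealExponent I) 1)

variable {P} in
/-- The divisorial ideal `T(a)`: the `k[P]`-module generated by the Laurent monomials whose
exponent vector `x` satisfies `σ_e(x) ≥ a_e` for all edges `e`. -/
def divIdeal (a : HEdge P → ℤ) : Submodule (hibiRing k P) (Laurent k P) :=
  Submodule.span (hibiRing k P)
    {m | ∃ x : WithBot P → ℤ, (∀ e, a e ≤ sigma x e) ∧ m = AddMonoidAlgebra.single x 1}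

variable {k P} in
/-- A conic divisorial ideal is `T(⌈σ_P(x)⌉)` for some real vector `x`. -/
def IsConic (M : Submodule (hibiRing k P) (Laurent k P)) : Prop :=
  ∃ x : WithBot P → ℝ, M = divIdeal k (fun e => ⌈sigma x e⌉)

/-- Isomorphism of `k[P]`-submodules of the Laurent polynomial ring, as abstract modules. -/
def isoSetoid : Setoid (Submodule (hibiRing k P) (Laurent k P)) where
  r M N := Nonempty (M ≃ₗ[hibiRing k P] N)
  iseqv :=
    { refl := fun M => ⟨LinearEquiv.refl _ M⟩
      symm := fun ⟨f⟩ => ⟨f.symm⟩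
      trans := fun ⟨f⟩ ⟨g⟩ => ⟨f.trans g⟩ }

/-- Isomorphism classes of `k[P]`-submodules of the Laurent polynomial ring. -/
abbrev IsoClass : Type (max u v) := Quotient (isoSetoid k P)

variable {k P} in
/-- The isomorphism class of a submodule. -/
def isoClass (M : Submodule (hibiRing k P) (Laurent k P)) : IsoClass k P :=
  Quotient.mk (isoSetoid k P) M

/-- The isomorphism classes of the divisorial ideals `T(a)`, `a` an integer vector. -/
def divisorialClasses : Set (IsoClass k P) :=
  Set.range fun a : HEdge P → ℤ => isoClass (divIdeal k a)

/-- The isomorphism classes of conic divisorial ideals. -/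
def conicClasses : Set (IsoClass k P) :=
  isoClass '' {M | IsConic M}

end Ring

section Polytope

variable {P : Type v} [PartialOrder P]

/-- A circuit of a graph: a cycle without chords. -/
def IsCircuit {V : Type*} {G : SimpleGraph V} {u : V} (C : G.Walk u u) : Prop :=
  C.IsCycle ∧ C.IsChordless

open scoped Classical in
/-- The signed characteristic vector of a cycle in the Hasse diagram: `1` on the edges traversed
upwards, `-1` on the edges traversed downwards, `0` on all other edges. -/
def signedVec {u : Hat P} (C : (SimpleGraph.hasse (Hat P)).Walk u u) (e : HEdge P) : ℤ :=
  if ∃ δ ∈ C.darts, δ.fst = e.1.1 ∧ δ.snd = e.1.2 then 1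
  else if ∃ δ ∈ C.darts, δ.fst = e.1.2 ∧ δ.snd = e.1.1 then -1
  else 0

/-- The set of edges traversed upwards by a cycle. -/
def suppPos {u : Hat P} (C : (SimpleGraph.hasse (Hat P)).Walk u u) : Set (HEdge P) :=
  {e | 0 < signedVec C e}

/-- The set of edges traversed downwards by a cycle. -/
def suppNeg {u : Hat P} (C : (SimpleGraph.hasse (Hat P)).Walk u u) : Set (HEdge P) :=
  {e | signedVec C e < 0}

/-- The edges of the Hasse diagram that do not belong to the subgraph `T`. -/
abbrev Cotree (T : SimpleGraph (Hat P)) : Type v :=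
  {e : HEdge P // ¬ T.Adj e.1.1 e.1.2}

instance [Finite P] (T : SimpleGraph (Hat P)) : Fintype (Cotree T) := Fintype.ofFinite _

/-- The polytope `C(P)`, in the coordinates indexed by the edges outside `T`. -/
def polytope [Finite P] (T : SimpleGraph (Hat P)) : Set (Cotree T → ℝ) :=
  {z | ∀ (u : Hat P) (C : (SimpleGraph.hasse (Hat P)).Walk u u), IsCircuit C →
    -((suppNeg C).ncard : ℝ) + 1 ≤ ∑ e : Cotree T, (signedVec C e.1 : ℝ) * z e ∧
    ∑ e : Cotree T, (signedVec C e.1 : ℝ) * z e ≤ ((suppPos C).ncard : ℝ) - 1}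

open scoped Classical in
/-- Extend an integer vector indexed by the edges outside `T` by `0` on the edges of `T`. -/
def extendZero (T : SimpleGraph (Hat P)) (z : Cotree T → ℤ) (e : HEdge P) : ℤ :=
  if h : T.Adj e.1.1 e.1.2 then 0 else z ⟨e, h⟩

end Polytope

end HibiConic

end

/-! Isomorphism classes. Every Laurent monomial is a quotient of monomials of k[P], so a linear map
from T(a) to L is multiplication by some f (`exists_forall_eq_mul`). For an isomorphism T(a) ≅ T(b)
this f is a unit of L, hence a monomial c·t^w (`exists_single_of_mul_eq_one`). Each inequality σ_e ≥
a_e is tight at some lattice point of T(a) (`exists_sigma_eq_and_le`), which forces b = a + σ(w).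
The classes are thus the cosets of the image of σ, and integral potentials on the spanning tree
single out in each coset the unique vector vanishing on the tree.

Conic classes. Such a vector a equals ⌈σ(x)⌉ when a_e - 1 < σ_e(x) ≤ a_e for all e. For the
potential -x these are difference constraints with bound 1 - a_e on an upward step and a_e on a
downward one, strict only upwards. Around a cycle C the bounds add up to |supp⁺(C)| - v(C)·a, which
must be positive because no cycle only descends; being an integer, it is at least 1. This is the
upper inequality for C and, with C reversed, the lower one. Conversely, a chord splits a cycle into
two shorter ones and opposite steps have total weight 1, so the bound 1 passes from circuits to all
cycles (`le_walkWeight_of_isCycle`). That leaves room to lower every step by 1/|P̂|, after which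
shortest-walk weights provide x (`exists_potential`). -/

namespace HibiConic

/-! ### Weights of walks: splitting at chords, shortcutting to paths -/

section WalkWeight

open SimpleGraph

variable {V : Type*} {G : SimpleGraph V} {A : Type*} [AddCommGroup A]

/-- The sum of `f a b` over the steps from `a` to `b` of a walk. -/
def walkWeight (f : V → V → A) {u v : V} (p : G.Walk u v) : A :=
  (p.darts.map fun δ => f δ.fst δ.snd).sum

@[simp]
theorem walkWeight_nil (f : V → V → A) (u : V) : walkWeight f (Walk.nil : G.Walk u u) = 0 := rfl

@[simp]
theorem walkWeight_cons (f : V → V → A) {u v w : V} (h : G.Adj u v) (p : G.Walk v w) :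
    walkWeight f (Walk.cons h p) = f u v + walkWeight f p := by
  simp [walkWeight]

theorem walkWeight_append (f : V → V → A) {u v w : V} (p : G.Walk u v) (q : G.Walk v w) :
    walkWeight f (p.append q) = walkWeight f p + walkWeight f q := by
  simp [walkWeight]

theorem walkWeight_rotate [DecidableEq V] (f : V → V → A) {u v : V} (C : G.Walk u u)
    (hv : v ∈ C.support) : walkWeight f (C.rotate v hv) = walkWeight f C :=
  ((C.rotate_darts v hv).perm.map _).sum_eq

theorem walkWeight_takeUntil_add_dropUntil [DecidableEq V] (f : V → V → A) {u v w : V}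
    (p : G.Walk u v) (hw : w ∈ p.support) :
    walkWeight f (p.takeUntil w hw) + walkWeight f (p.dropUntil w hw) = walkWeight f p := by
  rw [← walkWeight_append, Walk.take_spec]

theorem walkWeight_sub (f g : V → V → A) {u v : V} (p : G.Walk u v) :
    walkWeight (fun a b => f a b - g a b) p = walkWeight f p - walkWeight g p := by
  induction p with
  | nil => simp
  | cons h p ih => simp only [walkWeight_cons, ih]; abel

theorem walkWeight_const (c : A) {u v : V} (p : G.Walk u v) :
    walkWeight (fun _ _ => c) p = p.length • c := by
  simp [walkWeight]

variable [LinearOrder A] [IsOrderedAddMonoid A]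

/-- If two opposite steps always have total weight at most `c`, and all circuits have weight at
least `c`, then all cycles have weight at least `c`. -/
theorem le_walkWeight_of_isCycle (f : V → V → A) (c : A)
    (hsymm : ∀ a b, G.Adj a b → f a b + f b a ≤ c)
    (hcirc : ∀ (u : V) (C : G.Walk u u), IsCircuit C → c ≤ walkWeight f C)
    {u : V} (C : G.Walk u u) (hC : C.IsCycle) : c ≤ walkWeight f C := by
  classical
  induction hn : C.length using Nat.strong_induction_on generalizing u C with
  | _ n ih =>
  by_cases hch : C.IsChordless
  · exact hcirc u C ⟨hC, hch⟩
  rw [Walk.isChordless_iff_forall_mem_edges] at hch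
  push Not at hch
  obtain ⟨s, t, hs, ht, hadj, hst⟩ := hch
  -- Start the cycle at the endpoint `s` of the chord, so that the other endpoint `t` cuts it into
  -- two arcs.
  have hC' : (C.rotate s hs).IsCycle := hC.rotate hs
  have ht' : t ∈ (C.rotate s hs).support := (C.mem_support_rotate_iff s hs).2 ht
  have hst' : s(s, t) ∉ (C.rotate s hs).edges := fun h =>
    hst ((C.rotate_edges s hs).mem_iff.1 h)
  have hw := walkWeight_rotate f C hs
  have hlen := C.length_rotate s hs
  generalize C.rotate s hs = D at *
  set p := D.takeUntil t ht'
  set q := D.dropUntil t ht'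
  have hpq : p.append q = D := D.take_spec ht'
  have hp : p.IsPath := hC'.isPath_takeUntil ht'
  have hq : q.IsPath :=
    Walk.IsCycle.isPath_of_append_right (p := p) (Walk.not_nil_of_ne hadj.ne) (hpq ▸ hC')
  have hpe : s(t, s) ∉ p.edges := fun h => hst' (by
    rw [← hpq, Walk.edges_append]; exact List.mem_append_left _ (Sym2.eq_swap ▸ h))
  have hqe : s(s, t) ∉ q.edges := fun h => hst' (by
    rw [← hpq, Walk.edges_append]; exact List.mem_append_right _ h)
  have hp' : (Walk.cons hadj.symm p).IsCycle := (Walk.cons_isCycle_iff _ _).2 ⟨hp, hpe⟩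
  have hq' : (Walk.cons hadj q).IsCycle := (Walk.cons_isCycle_iff _ _).2 ⟨hq, hqe⟩
  have l1 := hp'.three_le_length
  have l2 := hq'.three_le_length
  have l3 : p.length + q.length = D.length := by rw [← hpq, Walk.length_append]
  rw [Walk.length_cons] at l1 l2
  have i1 := ih _ (by rw [Walk.length_cons]; omega) _ hp' rfl
  have i2 := ih _ (by rw [Walk.length_cons]; omega) _ hq' rfl
  rw [walkWeight_cons] at i1 i2
  have h3 := walkWeight_append f p q
  rw [hpq, hw] at h3
  have h4 := hsymm s t hadj
  -- The arcs closed by the chord are two shorter cycles; together they weigh as much as `C` plus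
  -- both directions of the chord.
  have h5 : c + c ≤ c + walkWeight f C := by
    calc c + c ≤ (f t s + walkWeight f p) + (f s t + walkWeight f q) := add_le_add i1 i2
      _ = (f s t + f t s) + walkWeight f C := by rw [h3]; abel
      _ ≤ c + walkWeight f C := by gcongr
  exact le_of_add_le_add_left h5

/-- If pairs of opposite steps and cycles have nonnegative weight, then every walk can be
shortcut to a path without increasing the weight. -/
theorem exists_isPath_walkWeight_le (f : V → V → A)
    (hsymm : ∀ a b, G.Adj a b → 0 ≤ f a b + f b a)
    (hcyc : ∀ (u : V) (C : G.Walk u u), C.IsCycle → 0 ≤ walkWeight f C)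
    {u v : V} (p : G.Walk u v) :
    ∃ q : G.Walk u v, q.IsPath ∧ walkWeight f q ≤ walkWeight f p := by
  classical
  induction p with
  | nil => exact ⟨Walk.nil, Walk.IsPath.nil, le_rfl⟩
  | @cons a b c h p ih =>
    obtain ⟨q, hq, hle⟩ := ih
    by_cases ha : a ∈ q.support
    · refine ⟨q.dropUntil a ha, hq.dropUntil ha, ?_⟩
      have key : 0 ≤ f a b + walkWeight f (q.takeUntil a ha) := by
        have hr : (q.takeUntil a ha).IsPath := hq.takeUntil ha
        generalize q.takeUntil a ha = r at hr ⊢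
        -- The excised closed walk is either a step followed by its reverse, or a cycle.
        by_cases he : s(a, b) ∈ r.edges
        · cases r with
          | nil => exact absurd rfl h.ne
          | @cons _ d _ h' r =>
            have hb := ((Walk.cons_isPath_iff _ _).1 hr).2
            have hd : a = d := by
              rw [Walk.edges_cons, List.mem_cons] at he
              rcases he with he | he
              · simpa [h.ne] using he
              · exact absurd (r.snd_mem_support_of_mem_edges he) hb
            subst hd
            have hnil : r = Walk.nil := by
              have := ((Walk.cons_isPath_iff _ _).1 hr).1
              simpa using this
            subst hnil
            simpa using hsymm a b h
        · simpa using hcyc _ _ ((Walk.cons_isCycle_iff r h).2 ⟨hr, he⟩)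
      have hs := walkWeight_takeUntil_add_dropUntil f q ha
      calc walkWeight f (q.dropUntil a ha)
          ≤ (f a b + walkWeight f (q.takeUntil a ha)) + walkWeight f (q.dropUntil a ha) :=
            le_add_of_nonneg_left key
        _ = f a b + walkWeight f q := by rw [← hs]; abel
        _ ≤ f a b + walkWeight f p := by gcongr
        _ = _ := (walkWeight_cons f h p).symm
    · exact ⟨Walk.cons h q, (Walk.cons_isPath_iff _ _).2 ⟨hq, ha⟩, by simpa using hle⟩

theorem walkWeight_nonneg_of_closed (f : V → V → A)
    (hsymm : ∀ a b, G.Adj a b → 0 ≤ f a b + f b a)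
    (hcyc : ∀ (u : V) (C : G.Walk u u), C.IsCycle → 0 ≤ walkWeight f C)
    {u : V} (p : G.Walk u u) : 0 ≤ walkWeight f p := by
  obtain ⟨q, hq, hle⟩ := exists_isPath_walkWeight_le f hsymm hcyc p
  have : q = Walk.nil := by simpa using hq
  subst this
  simpa using hle

end WalkWeight

/-! ### Difference constraints and shortest-walk potentials -/

section Potential

open SimpleGraph

variable {V : Type*} {G : SimpleGraph V} {A : Type*} [AddCommGroup A]
  [ConditionallyCompleteLinearOrder A] [IsOrderedAddMonoid A]

/-- A system of difference constraints along the edges of a connected graph is solvable if pairs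
of opposite steps and cycles have nonnegative weight. -/
theorem exists_potential (hG : G.Connected) (f : V → V → A)
    (hsymm : ∀ a b, G.Adj a b → 0 ≤ f a b + f b a)
    (hcyc : ∀ (u : V) (C : G.Walk u u), C.IsCycle → 0 ≤ walkWeight f C) :
    ∃ F : V → A, ∀ a b, G.Adj a b → F a - F b ≤ f a b := by
  obtain ⟨r⟩ := hG.nonempty
  have hne : ∀ a, Nonempty (G.Walk a r) := fun a => hG.preconnected a r
  -- Closing up with a fixed walk back from `r` bounds all weights from below.
  have hbdd : ∀ a, BddBelow (Set.range fun p : G.Walk a r => walkWeight f p) := by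
    intro a
    obtain ⟨q⟩ := hG.preconnected r a
    refine ⟨-walkWeight f q, ?_⟩
    rintro _ ⟨p, rfl⟩
    have := walkWeight_nonneg_of_closed f hsymm hcyc (p.append q)
    rw [walkWeight_append] at this
    exact neg_le_iff_add_nonneg.2 this
  refine ⟨fun a => ⨅ p : G.Walk a r, walkWeight f p, fun a b h => ?_⟩
  rw [sub_le_comm]
  refine le_ciInf fun p => ?_
  rw [sub_le_iff_le_add']
  exact (ciInf_le (hbdd a) (Walk.cons h p)).trans (walkWeight_cons f h p).le

/-- An antisymmetric function on the edges of a tree is the coboundary of a potential. -/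
theorem exists_potential_of_isTree (hG : G.IsTree) (f : V → V → A)
    (hf : ∀ a b, f b a = -f a b) :
    ∃ F : V → A, ∀ a b, G.Adj a b → F a - F b = f a b := by
  -- A tree has no cycles, so only opposite pairs matter, and these cancel by antisymmetry.
  obtain ⟨F, hF⟩ := exists_potential hG.connected f (fun a b _ => by simp [hf a b])
    (fun u C hC => absurd hC (hG.isAcyclic C))
  refine ⟨F, fun a b h => le_antisymm (hF a b h) ?_⟩
  have := hF b a h.symm
  rwa [hf a b, le_neg, neg_sub] at this

end Potential

end HibiConic

noncomputable section
namespace HibiConic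

/-! ### The inequalities of the polytope as weights of cycles -/

section CycleWeights

open SimpleGraph

variable {P : Type v} [PartialOrder P] {A : Type*}

open scoped Classical in
/-- The antisymmetric function on ordered pairs of adjacent vertices determined by a function on
the edges. -/
def stepVal [AddGroup A] (a : HEdge P → A) (u v : Hat P) : A :=
  if h : u ⋖ v then a ⟨(u, v), h⟩ else if h : v ⋖ u then -a ⟨(v, u), h⟩ else 0

theorem stepVal_up [AddGroup A] (a : HEdge P → A) {u v : Hat P} (h : u ⋖ v) :
    stepVal a u v = a ⟨(u, v), h⟩ := by simp [stepVal, h]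

theorem not_covBy_symm {V : Type*} [PartialOrder V] {u v : V} (h : u ⋖ v) : ¬ v ⋖ u :=
  fun h' => h.lt.asymm h'.lt

theorem stepVal_down [AddGroup A] (a : HEdge P → A) {u v : Hat P} (h : v ⋖ u) :
    stepVal a u v = -a ⟨(v, u), h⟩ := by
  simp [stepVal, h, not_covBy_symm h]

theorem stepVal_antisymm [AddCommGroup A] (a : HEdge P → A) (u v : Hat P) :
    stepVal a v u = -stepVal a u v := by
  by_cases h : u ⋖ v
  · rw [stepVal_up a h, stepVal_down a h]
  by_cases h' : v ⋖ u
  · rw [stepVal_up a h', stepVal_down a h', neg_neg]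
  · simp [stepVal, h, h']

open scoped Classical in
/-- Step weights encoding the upper bound that a cycle imposes. -/
def upWeight (a : HEdge P → ℝ) (u v : Hat P) : ℝ := (if u ⋖ v then 1 else 0) - stepVal a u v

open scoped Classical in
/-- Step weights encoding the lower bound that a cycle imposes. -/
def downWeight (a : HEdge P → ℝ) (u v : Hat P) : ℝ := (if v ⋖ u then 1 else 0) + stepVal a u v

theorem upWeight_up (a : HEdge P → ℝ) {u v : Hat P} (h : u ⋖ v) :
    upWeight a u v = 1 - a ⟨(u, v), h⟩ := by simp [upWeight, h, stepVal_up a h]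

theorem upWeight_down (a : HEdge P → ℝ) {u v : Hat P} (h : v ⋖ u) :
    upWeight a u v = a ⟨(v, u), h⟩ := by
  simp [upWeight, not_covBy_symm h, stepVal_down a h]

theorem downWeight_up (a : HEdge P → ℝ) {u v : Hat P} (h : u ⋖ v) :
    downWeight a u v = a ⟨(u, v), h⟩ := by
  simp [downWeight, not_covBy_symm h, stepVal_up a h]

theorem downWeight_down (a : HEdge P → ℝ) {u v : Hat P} (h : v ⋖ u) :
    downWeight a u v = 1 - a ⟨(v, u), h⟩ := by
  simp [downWeight, h, stepVal_down a h, sub_eq_add_neg]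

/-- The value 1 is the length of the interval (a_e - 1, a_e] allowed for σ_e(x). -/
theorem upWeight_add_swap (a : HEdge P → ℝ) {u v : Hat P} (h : (hasse (Hat P)).Adj u v) :
    upWeight a u v + upWeight a v u = 1 := by
  rcases h with h | h <;> rw [upWeight_up a h, upWeight_down a h] <;> ring

/-- A walk traverses the edge `e` upwards. -/
def GoesUp {u v : Hat P} (C : (hasse (Hat P)).Walk u v) (e : HEdge P) : Prop :=
  ∃ δ ∈ C.darts, δ.fst = e.1.1 ∧ δ.snd = e.1.2

/-- A walk traverses the edge `e` downwards. -/
def GoesDown {u v : Hat P} (C : (hasse (Hat P)).Walk u v) (e : HEdge P) : Prop :=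
  ∃ δ ∈ C.darts, δ.fst = e.1.2 ∧ δ.snd = e.1.1

theorem GoesUp.mem_edges {u v : Hat P} {C : (hasse (Hat P)).Walk u v} {e : HEdge P}
    (h : GoesUp C e) : s(e.1.1, e.1.2) ∈ C.edges := by
  obtain ⟨δ, hδ, h1, h2⟩ := h
  exact List.mem_map.2 ⟨δ, hδ, by rw [← h1, ← h2]; rfl⟩

theorem GoesDown.mem_edges {u v : Hat P} {C : (hasse (Hat P)).Walk u v} {e : HEdge P}
    (h : GoesDown C e) : s(e.1.2, e.1.1) ∈ C.edges := by
  obtain ⟨δ, hδ, h1, h2⟩ := h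
  exact List.mem_map.2 ⟨δ, hδ, by rw [← h1, ← h2]; rfl⟩

theorem goesUp_cons {u v w : Hat P} (h : (hasse (Hat P)).Adj u v) (p : (hasse (Hat P)).Walk v w)
    (e : HEdge P) : GoesUp (Walk.cons h p) e ↔ (u = e.1.1 ∧ v = e.1.2) ∨ GoesUp p e := by
  simp [GoesUp]

theorem goesDown_cons {u v w : Hat P} (h : (hasse (Hat P)).Adj u v)
    (p : (hasse (Hat P)).Walk v w) (e : HEdge P) :
    GoesDown (Walk.cons h p) e ↔ (u = e.1.2 ∧ v = e.1.1) ∨ GoesDown p e := by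
  simp [GoesDown]

theorem not_goesUp_and_goesDown {u v : Hat P} {C : (hasse (Hat P)).Walk u v} (hC : C.IsTrail)
    {e : HEdge P} (h : GoesUp C e) (h' : GoesDown C e) : False := by
  obtain ⟨δ, hδ, h1, h2⟩ := h
  obtain ⟨η, hη, h3, h4⟩ := h'
  have : δ = η := List.inj_on_of_nodup_map hC.edges_nodup hδ hη (by
    change s(δ.fst, δ.snd) = s(η.fst, η.snd)
    rw [h1, h2, h3, h4, Sym2.eq_swap])
  subst this
  exact e.2.lt.ne (h1.symm.trans h3)

open scoped Classical in
/-- The weight of a trail as a sum over the edges of the Hasse diagram. -/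
theorem walkWeight_eq_sum [AddCommGroup A] [Fintype (HEdge P)] (f : Hat P → Hat P → A)
    {u v : Hat P} (C : (hasse (Hat P)).Walk u v) (hC : C.IsTrail) :
    walkWeight f C = ∑ e : HEdge P,
      ((if GoesUp C e then f e.1.1 e.1.2 else 0) + (if GoesDown C e then f e.1.2 e.1.1 else 0)) := by
  induction C with
  | nil => simp [GoesUp, GoesDown]
  | @cons u v w h p ih =>
    have hp := (Walk.isTrail_cons h p).1 hC
    rw [walkWeight_cons, ih hp.1]
    have hone : f u v = ∑ e : HEdge P, ((if u = e.1.1 ∧ v = e.1.2 then f e.1.1 e.1.2 else 0) +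
        (if u = e.1.2 ∧ v = e.1.1 then f e.1.2 e.1.1 else 0)) := by
      rcases h with h | h
      · rw [Finset.sum_eq_single_of_mem (⟨(u, v), h⟩ : HEdge P) (Finset.mem_univ _)]
        · simp [h.lt.ne]
        · rintro ⟨⟨p, q⟩, hpq⟩ - hne
          rw [if_neg, if_neg, add_zero]
          · rintro ⟨rfl, rfl⟩
            exact not_covBy_symm h hpq
          · rintro ⟨rfl, rfl⟩
            exact hne rfl
      · rw [Finset.sum_eq_single_of_mem (⟨(v, u), h⟩ : HEdge P) (Finset.mem_univ _)]
        · simp [h.lt.ne]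
        · rintro ⟨⟨p, q⟩, hpq⟩ - hne
          rw [if_neg, if_neg, add_zero]
          · rintro ⟨rfl, rfl⟩
            exact hne rfl
          · rintro ⟨rfl, rfl⟩
            exact not_covBy_symm h hpq
    rw [hone, ← Finset.sum_add_distrib]
    refine Finset.sum_congr rfl fun e _ => ?_
    -- A trail does not repeat the edge of its first step, so the indicators of head and tail are
    -- disjoint and add up.
    have h1 : ¬ ((u = e.1.1 ∧ v = e.1.2) ∧ GoesUp p e) := by
      rintro ⟨⟨rfl, rfl⟩, h'⟩
      exact hp.2 h'.mem_edges
    have h2 : ¬ ((u = e.1.2 ∧ v = e.1.1) ∧ GoesDown p e) := by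
      rintro ⟨⟨rfl, rfl⟩, h'⟩
      exact hp.2 h'.mem_edges
    simp only [goesUp_cons, goesDown_cons]
    rw [add_add_add_comm]
    congr 1 <;> split_ifs <;> simp_all

open scoped Classical in
theorem signedVec_eq {u : Hat P} (C : (hasse (Hat P)).Walk u u) (e : HEdge P) :
    signedVec C e = if GoesUp C e then 1 else if GoesDown C e then -1 else 0 := by
  unfold signedVec GoesUp GoesDown
  split_ifs <;> rfl

open scoped Classical in
theorem ncard_eq_sum_ite {α : Type*} [Fintype α] (s : Set α) :
    (s.ncard : ℝ) = ∑ a, if a ∈ s then (1 : ℝ) else 0 := by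
  rw [Finset.sum_boole, Set.ncard_eq_toFinset_card', Set.toFinset]
  congr 2
  ext; simp

/-- An upward edge contributes 1 - a_e and a downward one a_e: the constants count `suppPos C`, the
rest is the signed sum. -/
theorem walkWeight_upWeight [Fintype (HEdge P)] (a : HEdge P → ℝ) {u : Hat P}
    (C : (hasse (Hat P)).Walk u u) (hC : C.IsTrail) :
    walkWeight (upWeight a) C =
      ((suppPos C).ncard : ℝ) - ∑ e, (signedVec C e : ℝ) * a e := by
  classical
  rw [walkWeight_eq_sum _ C hC, ncard_eq_sum_ite, ← Finset.sum_sub_distrib]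
  refine Finset.sum_congr rfl fun e _ => ?_
  rw [upWeight_up a e.2, upWeight_down a e.2]
  simp only [suppPos, Set.mem_ofPred_eq, signedVec_eq]
  by_cases h1 : GoesUp C e <;> by_cases h2 : GoesDown C e
  · exact (not_goesUp_and_goesDown hC h1 h2).elim
  all_goals simp [h1, h2]

theorem walkWeight_downWeight [Fintype (HEdge P)] (a : HEdge P → ℝ) {u : Hat P}
    (C : (hasse (Hat P)).Walk u u) (hC : C.IsTrail) :
    walkWeight (downWeight a) C =
      ((suppNeg C).ncard : ℝ) + ∑ e, (signedVec C e : ℝ) * a e := by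
  classical
  rw [walkWeight_eq_sum _ C hC, ncard_eq_sum_ite, ← Finset.sum_add_distrib]
  refine Finset.sum_congr rfl fun e _ => ?_
  rw [downWeight_up a e.2, downWeight_down a e.2]
  simp only [suppNeg, Set.mem_ofPred_eq, signedVec_eq]
  by_cases h1 : GoesUp C e <;> by_cases h2 : GoesDown C e
  · exact (not_goesUp_and_goesDown hC h1 h2).elim
  all_goals simp [h1, h2, sub_eq_add_neg]

end CycleWeights

/-! ### The polytope: cycle form of its inequalities, boundedness -/

section Polytope

open SimpleGraph

variable {P : Type v} [PartialOrder P]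

open scoped Classical in
/-- Extend a vector indexed by the edges outside `T` by `0` on the edges of `T`. -/
def cotreeExtend {A : Type*} [Zero A] (T : SimpleGraph (Hat P)) (z : Cotree T → A) (e : HEdge P) :
    A :=
  if h : T.Adj e.1.1 e.1.2 then 0 else z ⟨e, h⟩

theorem cotreeExtend_of_adj {A : Type*} [Zero A] {T : SimpleGraph (Hat P)} (z : Cotree T → A)
    {e : HEdge P} (h : T.Adj e.1.1 e.1.2) : cotreeExtend T z e = 0 := by simp [cotreeExtend, h]

theorem cotreeExtend_coe {A : Type*} [Zero A] {T : SimpleGraph (Hat P)} (z : Cotree T → A)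
    (e : Cotree T) : cotreeExtend T z e.1 = z e := by simp [cotreeExtend, e.2]

theorem cotreeExtend_cast (T : SimpleGraph (Hat P)) (z : Cotree T → ℤ) :
    cotreeExtend T (fun e => (z e : ℝ)) = fun e => ((cotreeExtend T z e : ℤ) : ℝ) := by
  funext e
  unfold cotreeExtend
  split_ifs <;> simp

theorem sum_mul_cotreeExtend [Fintype (HEdge P)] (T : SimpleGraph (Hat P)) [Fintype (Cotree T)]
    (f : HEdge P → ℝ) (z : Cotree T → ℝ) :
    ∑ e, f e * cotreeExtend T z e = ∑ e : Cotree T, f e.1 * z e := by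
  classical
  symm
  rw [← Finset.sum_filter_of_ne (p := fun e : HEdge P => ¬ T.Adj e.1.1 e.1.2)
    (fun e _ h hadj => h (by rw [cotreeExtend_of_adj z hadj, mul_zero])),
    Finset.sum_subtype (p := fun e : HEdge P => ¬ T.Adj e.1.1 e.1.2) _ (by simp)]
  exact Finset.sum_congr rfl fun e _ => by rw [cotreeExtend_coe z e]

theorem mem_polytope_iff [Finite P] (T : SimpleGraph (Hat P)) (z : Cotree T → ℝ) :
    z ∈ polytope T ↔ ∀ (u : Hat P) (C : (hasse (Hat P)).Walk u u), IsCircuit C →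
      1 ≤ walkWeight (upWeight (cotreeExtend T z)) C ∧
        1 ≤ walkWeight (downWeight (cotreeExtend T z)) C := by
  have := Fintype.ofFinite (HEdge P)
  refine forall_congr' fun u => forall_congr' fun C => forall_congr' fun hC => ?_
  rw [walkWeight_upWeight _ C hC.1.isTrail, walkWeight_downWeight _ C hC.1.isTrail,
    sum_mul_cotreeExtend]
  constructor <;> rintro ⟨h1, h2⟩ <;> constructor <;> linarith

/-- Chord splitting with c = 1. The upper bounds suffice, since the lower bound for a circuit is the
upper bound for its reversal. -/
theorem one_le_upWeight_of_isCycle [Finite P] {T : SimpleGraph (Hat P)} {z : Cotree T → ℝ}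
    (hz : z ∈ polytope T) {u : Hat P} (C : (hasse (Hat P)).Walk u u) (hC : C.IsCycle) :
    1 ≤ walkWeight (upWeight (cotreeExtend T z)) C :=
  le_walkWeight_of_isCycle _ 1 (fun _ _ h => (upWeight_add_swap _ h).le)
    (fun u C hC => ((mem_polytope_iff T z).1 hz u C hC).1) C hC

theorem upWeight_le_one_of_adj {T : SimpleGraph (Hat P)} (hT : T ≤ hasse (Hat P))
    (z : Cotree T → ℝ) {u v : Hat P} (h : T.Adj u v) : upWeight (cotreeExtend T z) u v ≤ 1 := by
  rcases hT h with h' | h'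
  · rw [upWeight_up _ h', cotreeExtend_of_adj z (by exact h), sub_zero]
  · rw [upWeight_down _ h', cotreeExtend_of_adj z (by exact h.symm)]
    exact zero_le_one

theorem walkWeight_mapLe_le {T : SimpleGraph (Hat P)} (hT : T ≤ hasse (Hat P))
    (z : Cotree T → ℝ) {u v : Hat P} (p : T.Walk u v) :
    walkWeight (upWeight (cotreeExtend T z)) (p.mapLe hT) ≤ p.length := by
  induction p with
  | nil => simp [Walk.mapLe]
  | cons h p ih =>
    have := upWeight_le_one_of_adj hT z h
    simp only [Walk.mapLe, Walk.map_cons, walkWeight_cons, Walk.length_cons] at ih ⊢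
    push_cast
    change upWeight (cotreeExtend T z) _ _ + _ ≤ _
    exact add_comm (_ : ℝ) 1 ▸ add_le_add this ih

/-- The fundamental cycle of an edge outside the spanning tree bounds its coordinate. -/
theorem one_le_upWeight_add_card [Finite P] {T : SimpleGraph (Hat P)} (hT : T ≤ hasse (Hat P))
    (hTree : T.IsTree) {z : Cotree T → ℝ} (hz : z ∈ polytope T) {u v : Hat P}
    (h : (hasse (Hat P)).Adj u v) (huv : ¬ T.Adj u v) :
    1 ≤ upWeight (cotreeExtend T z) u v + Nat.card (Hat P) := by
  classical
  have : Finite (Hat P) := inferInstanceAs (Finite (Option (Option P)))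
  have := Fintype.ofFinite (Hat P)
  obtain ⟨p⟩ := hTree.connected.preconnected v u
  have hp := p.bypass_isPath
  have hcyc : (Walk.cons h (p.bypass.mapLe hT)).IsCycle := by
    refine (Walk.cons_isCycle_iff _ _).2 ⟨(Walk.isPath_mapLe hT).2 hp, fun he => huv ?_⟩
    rw [Walk.edges_mapLe_eq_edges] at he
    exact p.bypass.adj_of_mem_edges he
  have h1 := one_le_upWeight_of_isCycle hz _ hcyc
  rw [walkWeight_cons] at h1
  have h2 := walkWeight_mapLe_le hT z p.bypass
  have h3 : (p.bypass.length : ℝ) ≤ Nat.card (Hat P) := by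
    rw [Nat.card_eq_fintype_card]
    exact_mod_cast hp.length_lt.le
  linarith

theorem isBounded_polytope [Finite P] {T : SimpleGraph (Hat P)} (hT : T ≤ hasse (Hat P))
    (hTree : T.IsTree) : Bornology.IsBounded (polytope T) := by
  refine (Metric.isBounded_Icc (fun _ => 1 - (Nat.card (Hat P) : ℝ))
    (fun _ => (Nat.card (Hat P) : ℝ))).subset fun z hz => ⟨fun e => ?_, fun e => ?_⟩
  -- Traversed downwards the edge weighs z_e, which bounds z_e below; traversed upwards it weighs 1
  -- - z_e, which bounds z_e above.
  · have := one_le_upWeight_add_card hT hTree hz (Or.inr e.1.2) (fun h => e.2 h.symm)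
    rw [upWeight_down _ e.1.2] at this
    erw [cotreeExtend_coe z e] at this
    simp only
    linarith
  · have := one_le_upWeight_add_card hT hTree hz (Or.inl e.1.2) e.2
    rw [upWeight_up _ e.1.2] at this
    erw [cotreeExtend_coe z e] at this
    simp only
    linarith

end Polytope

/-! ### Lattice points of the polytope and rounded-up vectors -/

section Feasibility

open SimpleGraph

variable {P : Type v} [PartialOrder P]

/-- A closed walk has positive weight if every step has at least the weight of a coboundary, and
strictly more weight unless it decreases with respect to `φ`. -/
theorem walkWeight_pos_of_closed {V O : Type*} [Preorder O] {G : SimpleGraph V} (φ : V → O)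
    (f : V → V → ℝ) (F : V → ℝ)
    (hf : ∀ a b, G.Adj a b → F a - F b < f a b ∨ (F a - F b ≤ f a b ∧ φ b < φ a))
    {u : V} (C : G.Walk u u) (hC : ¬ C.Nil) : 0 < walkWeight f C := by
  -- Equality survives only while every step decreases `φ`, which a nonempty closed walk cannot do.
  have key : ∀ {u v : V} (p : G.Walk u v), F u - F v < walkWeight f p ∨
      (F u - F v ≤ walkWeight f p ∧ (p.Nil ∨ φ v < φ u)) := by
    intro u v p
    induction p with
    | nil => simp
    | cons h p ih =>
      rw [walkWeight_cons]
      rcases hf _ _ h with h1 | ⟨h1, h2⟩ <;> rcases ih with h3 | ⟨h3, h4⟩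
      · left; linarith
      · left; linarith
      · left; linarith
      · refine Or.inr ⟨by linarith, Or.inr ?_⟩
        rcases h4 with h4 | h4
        · rwa [h4.eq] at h2
        · exact h4.trans h2
  rcases key C with h | ⟨h, h' | h'⟩
  · simpa using h
  · exact absurd h' hC
  · exact absurd h' (lt_irrefl _)

theorem extendTop_restrict {Q : Type*} {A : Type*} [AddGroup A] (F : Hat Q → A) (u : Hat Q) :
    extendTop (fun p : WithBot Q => F p - F ⊤) u = F u - F ⊤ := by
  induction u using WithTop.recTopCoe with
  | top => simp [extendTop]
  | coe p => rfl

theorem sigma_restrict {A : Type*} [AddGroup A] (F : Hat P → A) (e : HEdge P) :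
    sigma (fun p : WithBot P => F p - F ⊤) e = F e.1.1 - F e.1.2 := by
  simp [sigma, extendTop_restrict]

/-- An integer vector that rounds up `σ x` for a real `x` lies in the polytope. -/
theorem mem_polytope_of_ceil_sigma [Finite P] {T : SimpleGraph (Hat P)} {z : Cotree T → ℤ}
    {x : WithBot P → ℝ} (hx : ∀ e, cotreeExtend T z e = ⌈sigma x e⌉) :
    (fun e => (z e : ℝ)) ∈ polytope T := by
  have := Fintype.ofFinite (HEdge P)
  rw [mem_polytope_iff]
  intro u C hC
  have hle : ∀ e, sigma x e ≤ cotreeExtend T z e := fun e => by rw [hx]; exact Int.le_ceil _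
  have hlt : ∀ e, ((cotreeExtend T z e : ℤ) : ℝ) < sigma x e + 1 := fun e => by
    rw [hx]; exact Int.ceil_lt_add_one _
  rw [cotreeExtend_cast]
  have h1 : 0 < walkWeight (upWeight fun e => ((cotreeExtend T z e : ℤ) : ℝ)) C := by
    refine walkWeight_pos_of_closed (fun p => p) _ (fun p => -extendTop x p) ?_ C hC.1.not_nil
    rintro a b (h | h)
    · have := hlt ⟨(a, b), h⟩
      rw [upWeight_up _ h]
      simp only [sigma] at this
      left; linarith
    · have := hle ⟨(b, a), h⟩
      rw [upWeight_down _ h]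
      simp only [sigma] at this
      exact Or.inr ⟨by linarith, h.lt⟩
  have h2 : 0 < walkWeight (downWeight fun e => ((cotreeExtend T z e : ℤ) : ℝ)) C := by
    refine walkWeight_pos_of_closed (fun p => OrderDual.toDual p) _ (extendTop x) ?_ C
      hC.1.not_nil
    rintro a b (h | h)
    · have := hle ⟨(a, b), h⟩
      rw [downWeight_up _ h]
      simp only [sigma] at this
      exact Or.inr ⟨by linarith, OrderDual.toDual_lt_toDual.2 h.lt⟩
    · have := hlt ⟨(b, a), h⟩
      rw [downWeight_down _ h]
      simp only [sigma] at this
      left; linarith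
  rw [walkWeight_upWeight _ C hC.1.isTrail] at h1 ⊢
  rw [walkWeight_downWeight _ C hC.1.isTrail] at h2 ⊢
  -- Both weights are integers, so positive means at least 1.
  norm_cast at *

/-- Every lattice point of the polytope comes from a real vector. -/
theorem exists_ceil_sigma_eq [Finite P] {T : SimpleGraph (Hat P)} (hT : T ≤ hasse (Hat P))
    (hTree : T.IsTree) {z : Cotree T → ℤ} (hz : (fun e => (z e : ℝ)) ∈ polytope T) :
    ∃ x : WithBot P → ℝ, ∀ e, cotreeExtend T z e = ⌈sigma x e⌉ := by
  classical
  have : Finite (Hat P) := inferInstanceAs (Finite (Option (Option P)))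
  have := Fintype.ofFinite (Hat P)
  have hcyc := fun {u} => one_le_upWeight_of_isCycle hz (u := u)
  rw [cotreeExtend_cast] at hcyc
  set a : HEdge P → ℝ := fun e => ((cotreeExtend T z e : ℤ) : ℝ)
  set N : ℝ := (Fintype.card (Hat P) : ℝ) with hNdef
  -- Two opposite steps keep weight 1 - 2/N ≥ 0 after lowering each by 1/N.
  have hN : 2 ≤ N := by
    have : 1 < Fintype.card (Hat P) := Fintype.one_lt_card
    rw [hNdef]
    exact_mod_cast this
  have hN0 : 0 < N := by linarith
  have hinv : N⁻¹ ≤ 2⁻¹ := inv_anti₀ two_pos hN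
  have hinv0 : 0 < N⁻¹ := inv_pos.2 hN0
  obtain ⟨F, hF⟩ := exists_potential (hTree.connected.mono hT)
    (fun u v => upWeight a u v - N⁻¹)
    (fun u v h => by
      have := upWeight_add_swap a h
      linarith)
    (fun u C hC => by
      rw [walkWeight_sub (upWeight a) (fun _ _ => N⁻¹), walkWeight_const, nsmul_eq_mul]
      have h1 := hcyc C hC
      -- A cycle has at most N steps, so it loses at most 1 of its weight, which is at least 1.
      have h2 : (C.length : ℝ) ≤ N := by
        have := hC.support_nodup.length_le_card
        rw [List.length_tail, Walk.length_support, Nat.add_sub_cancel] at this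
        rw [hNdef]
        exact_mod_cast this
      have h3 : (C.length : ℝ) * N⁻¹ ≤ N * N⁻¹ := by gcongr
      rw [mul_inv_cancel₀ hN0.ne'] at h3
      linarith)
  -- The potential is -x, normalized at the top; the slack 1/N makes the lower bound strict, as the
  -- ceiling requires.
  refine ⟨fun p => -F p - -F ⊤, fun e => ?_⟩
  rw [sigma_restrict (fun p => -F p), eq_comm, Int.ceil_eq_iff]
  have h1 := hF _ _ (Or.inl e.2)
  have h2 := hF _ _ (Or.inr e.2)
  rw [upWeight_up _ e.2] at h1
  rw [upWeight_down _ e.2] at h2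
  change F e.1.1 - F e.1.2 ≤ 1 - ((cotreeExtend T z e : ℤ) : ℝ) - N⁻¹ at h1
  change F e.1.2 - F e.1.1 ≤ ((cotreeExtend T z e : ℤ) : ℝ) - N⁻¹ at h2
  constructor <;> linarith

end Feasibility
end HibiConic
end

noncomputable section
namespace HibiConic

/-! ### The map σ and tightness of its inequalities -/

section Sigma

variable {P : Type v} [PartialOrder P] {A : Type*} [AddCommGroup A]

theorem extendTop_add {Q : Type*} (x y : WithBot Q → A) (u : Hat Q) :
    extendTop (x + y) u = extendTop x u + extendTop y u := by
  induction u using WithTop.recTopCoe with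
  | top => simp [extendTop]
  | coe p => rfl

theorem sigma_add (x y : WithBot P → A) (e : HEdge P) :
    sigma (x + y) e = sigma x e + sigma y e := by
  simp only [sigma, extendTop_add]; abel

theorem sigma_neg (x : WithBot P → A) (e : HEdge P) : sigma (-x) e = -sigma x e := by
  have h := sigma_add x (-x) e
  rw [add_neg_cancel] at h
  have h0 : sigma (0 : WithBot P → A) e = 0 := by
    have := sigma_add (0 : WithBot P → A) 0 e
    rwa [add_zero, left_eq_add] at this
  rw [h0] at h
  exact (neg_eq_of_add_eq_zero_right h.symm).symm

theorem sigma_sub (x y : WithBot P → A) (e : HEdge P) :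
    sigma (x - y) e = sigma x e - sigma y e := by
  rw [sub_eq_add_neg, sigma_add, sigma_neg, sub_eq_add_neg]

theorem sigma_zero (e : HEdge P) : sigma (0 : WithBot P → A) e = 0 := by
  rw [← sub_self (0 : WithBot P → A), sigma_sub, sub_self]

theorem sigma_intCast (w : WithBot P → ℤ) (e : HEdge P) :
    sigma (fun p => (w p : ℝ)) e = (sigma w e : ℤ) := by
  have : ∀ u, extendTop (fun p => (w p : ℝ)) u = (extendTop w u : ℤ) := by
    intro u
    induction u using WithTop.recTopCoe with
    | top => simp [extendTop]
    | coe p => rfl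
  simp [sigma, this]

/-- There is a function on `Hat P` that takes the same value at both ends of a given edge and
strictly decreases along all other edges. -/
theorem exists_strict_outside_edge [Finite P] (e₀ : HEdge P) :
    ∃ F : Hat P → ℤ, F e₀.1.1 = F e₀.1.2 ∧ ∀ e : HEdge P, e ≠ e₀ → F e.1.2 < F e.1.1 := by
  classical
  have : Finite (Hat P) := inferInstanceAs (Finite (Option (Option P)))
  obtain ⟨⟨p, q⟩, hpq⟩ := e₀
  -- The up-set of `u` in the preorder obtained by adding the relation q ≤ p, which identifies the
  -- ends of the edge.
  let U : Hat P → Set (Hat P) := fun u => {w | u ≤ w ∨ (u ≤ q ∧ p ≤ w)}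
  have hpqU : U p = U q := by
    ext w
    constructor
    · rintro (h | ⟨-, h⟩) <;> exact Or.inr ⟨le_rfl, h⟩
    · rintro (h | ⟨-, h⟩)
      · exact Or.inl (hpq.le.trans h)
      · exact Or.inl h
  refine ⟨fun u => (U u).ncard, by simp only [hpqU], ?_⟩
  rintro ⟨⟨u, u'⟩, huu⟩ hne
  have hlt : (U u').ncard < (U u).ncard := by
    refine Set.ncard_lt_ncard ⟨?_, fun hsub => ?_⟩ (Set.toFinite _)
    · rintro w (h | ⟨h, h'⟩)
      · exact Or.inl (huu.le.trans h)
      · exact Or.inr ⟨huu.le.trans h, h'⟩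
    -- If `u'` still reaches `u`, then p ≤ u < u' ≤ q, and the covering p ⋖ q leaves only the edge
    -- `e₀` itself.
    · rcases hsub (show u ∈ U u from Or.inl le_rfl) with h | ⟨h1, h2⟩
      · exact huu.lt.not_ge h
      · have hq : u' = q := by
          by_contra h
          exact hpq.2 (h2.trans_lt huu.lt) (lt_of_le_of_ne h1 h)
        have hp : u = p := by
          by_contra h
          exact hpq.2 (lt_of_le_of_ne h2 (Ne.symm h)) (huu.lt.trans_le h1)
        subst hq hp
        exact hne rfl
  exact Int.ofNat_lt.2 hlt

/-- Each of the inequalities `a e ≤ σ_e x` is attained by an integer solution of all of them. -/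
theorem exists_sigma_eq_and_le [Finite P] (a : HEdge P → ℤ) (e₀ : HEdge P) :
    ∃ x : WithBot P → ℤ, sigma x e₀ = a e₀ ∧ ∀ e, a e ≤ sigma x e := by
  classical
  obtain ⟨F, hF0, hF⟩ := exists_strict_outside_edge e₀
  let g : Hat P → ℤ := fun u => if u = e₀.1.1 then a e₀ else 0
  obtain ⟨M, hM⟩ := Finite.exists_le fun e : HEdge P => a e - (g e.1.1 - g e.1.2)
  let N : ℤ := max M 0
  -- `F` is flat on `e₀`, so `g` alone sets the value there; a large multiple of `F` satisfies the
  -- other inequalities.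
  let H : Hat P → ℤ := fun u => N * F u + g u
  have h0 : sigma (fun p : WithBot P => H p - H ⊤) e₀ = a e₀ := by
    rw [sigma_restrict]
    simp [H, g, hF0, e₀.2.lt.ne']
  refine ⟨fun p : WithBot P => H p - H ⊤, h0, fun e => ?_⟩
  by_cases he : e = e₀
  · rw [he, h0]
  rw [sigma_restrict]
  have h1 := hF e he
  have h2 : a e - (g e.1.1 - g e.1.2) ≤ N := (hM e).trans (le_max_left _ _)
  have h3 : 0 ≤ N := le_max_right _ _
  have h4 : N * 1 ≤ N * (F e.1.1 - F e.1.2) := mul_le_mul_of_nonneg_left (by omega) h3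
  simp only [H]
  linarith

theorem exists_le_sigma [Finite P] (a : HEdge P → ℤ) :
    ∃ x : WithBot P → ℤ, ∀ e, a e ≤ sigma x e := by
  rcases isEmpty_or_nonempty (HEdge P) with h | ⟨⟨e₀⟩⟩
  · exact ⟨0, fun e => h.elim e⟩
  · obtain ⟨x, -, hx⟩ := exists_sigma_eq_and_le a e₀
    exact ⟨x, hx⟩

/-- The indicator of a down-set never increases along a cover; it is 1 at the bottom and 0 at the
top. -/
theorem sigma_idealExponent_nonneg (I : LowerSet P) (e : HEdge P) :
    0 ≤ sigma (idealExponent I) e := by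
  classical
  obtain ⟨⟨p, q⟩, hpq⟩ := e
  have hlt := hpq.lt
  induction q using WithTop.recTopCoe with
  | top =>
    induction p using WithTop.recTopCoe with
    | top => exact absurd hlt (lt_irrefl _)
    | coe p =>
      cases p with
      | bot => exact (by norm_num : (0 : ℤ) ≤ 1 - 0)
      | coe p => simp only [sigma, extendTop, idealExponent, WithTop.recTopCoe_coe,
                  WithTop.recTopCoe_top, WithBot.recBotCoe_coe]; split_ifs <;> simp
  | coe q =>
    induction p using WithTop.recTopCoe with
    | top => exact absurd hlt not_top_lt
    | coe p =>
      rw [WithTop.coe_lt_coe] at hlt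
      cases q with
      | bot => exact absurd hlt not_lt_bot
      | coe q =>
        cases p with
        | bot => simp only [sigma, extendTop, idealExponent, WithTop.recTopCoe_coe,
                  WithBot.recBotCoe_bot, WithBot.recBotCoe_coe]; split_ifs <;> simp
        | coe p =>
          rw [WithBot.coe_lt_coe] at hlt
          have := I.lower hlt.le
          simp only [sigma, extendTop, idealExponent, WithTop.recTopCoe_coe,
            WithBot.recBotCoe_coe]
          by_cases h : q ∈ I
          · simp [h, show p ∈ I from this h]
          · simp only [h, if_false]; split_ifs <;> simp

end Sigma

/-! ### Units of the Laurent polynomial ring -/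

section Units

variable {k : Type u} [Field k] {G : Type*} [AddCommGroup G] [TwoUniqueSums G]

/-- If two elements of a group algebra multiply to `1` and any two finite sets of exponents have
two unique sums, then both are monomials. -/
theorem exists_single_of_mul_eq_one {f g : AddMonoidAlgebra k G} (h : f * g = 1) :
    ∃ (w : G) (c d : k), c ≠ 0 ∧ d ≠ 0 ∧ f = AddMonoidAlgebra.single w c ∧
      g = AddMonoidAlgebra.single (-w) d := by
  classical
  have hone : ∀ m : G, m ≠ 0 → (1 : AddMonoidAlgebra k G).coeff m = 0 := by
    intro m hm
    rw [AddMonoidAlgebra.one_def, AddMonoidAlgebra.coeff_single, Finsupp.single_apply,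
      if_neg hm.symm]
  have hsum : ∀ a ∈ f.coeff.support, ∀ b ∈ g.coeff.support,
      UniqueAdd f.coeff.support g.coeff.support a b → a + b = 0 := by
    intro a ha b hb hu
    by_contra hne
    have h1 := AddMonoidAlgebra.coeff_mul_add_of_uniqueAdd hu
    rw [h, hone _ hne] at h1
    exact mul_ne_zero (Finsupp.mem_support_iff.1 ha) (Finsupp.mem_support_iff.1 hb) h1.symm
  -- Two distinct unique sums would both have to be 0, contradicting uniqueness; hence both supports
  -- are singletons.
  have hcard : ¬ 1 < f.coeff.support.card * g.coeff.support.card := by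
    intro hlt
    obtain ⟨p, hp, q, hq, hne, hup, huq⟩ := TwoUniqueSums.uniqueAdd_of_one_lt_card hlt
    rw [Finset.mem_product] at hp hq
    have h1 := hsum _ hp.1 _ hp.2 hup
    have h2 := hsum _ hq.1 _ hq.2 huq
    have := hup hq.1 hq.2 (h2.trans h1.symm)
    exact hne (Prod.ext this.1.symm this.2.symm)
  have hf : f ≠ 0 := left_ne_zero_of_mul_eq_one h
  have hg : g ≠ 0 := right_ne_zero_of_mul_eq_one h
  have hf' : 0 < f.coeff.support.card := by
    rw [Finset.card_pos, Finsupp.support_nonempty_iff]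
    exact fun h => hf (AddMonoidAlgebra.coeff_eq_zero.1 h)
  have hg' : 0 < g.coeff.support.card := by
    rw [Finset.card_pos, Finsupp.support_nonempty_iff]
    exact fun h => hg (AddMonoidAlgebra.coeff_eq_zero.1 h)
  have hf1 : f.coeff.support.card = 1 := by nlinarith
  have hg1 : g.coeff.support.card = 1 := by nlinarith
  obtain ⟨w, c, hc, hfw⟩ := Finsupp.card_support_eq_one'.1 hf1
  obtain ⟨w', d, hd, hgw⟩ := Finsupp.card_support_eq_one'.1 hg1
  have hf2 : f = AddMonoidAlgebra.single w c := AddMonoidAlgebra.coeff_injective hfw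
  have hg2 : g = AddMonoidAlgebra.single w' d := AddMonoidAlgebra.coeff_injective hgw
  refine ⟨w, c, d, hc, hd, hf2, ?_⟩
  rw [hf2, hg2, AddMonoidAlgebra.single_mul_single, AddMonoidAlgebra.one_def,
    AddMonoidAlgebra.single_inj] at h
  rcases h with h | h
  · rw [hg2, eq_neg_of_add_eq_zero_right h.1]
  · exact absurd h.2 one_ne_zero

end Units

/-! ### Divisorial ideals up to isomorphism -/

section Ideals

open AddMonoidAlgebra

variable {k : Type u} [Field k] {P : Type v} [PartialOrder P]

/-- All exponents `y` of `f` satisfy `σ_e y ≥ a_e`. -/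
def ExponentsGE (a : HEdge P → ℤ) (f : Laurent k P) : Prop :=
  ∀ y, f.coeff y ≠ 0 → ∀ e, a e ≤ sigma y e

theorem ExponentsGE.add {a : HEdge P → ℤ} {f g : Laurent k P} (hf : ExponentsGE a f)
    (hg : ExponentsGE a g) : ExponentsGE a (f + g) := by
  intro y hy
  by_cases h : f.coeff y = 0
  · by_cases h' : g.coeff y = 0
    · exact absurd (by rw [coeff_add, Finsupp.add_apply, h, h', add_zero]) hy
    · exact hg y h'
  · exact hf y h

theorem ExponentsGE.mul {a b : HEdge P → ℤ} {f g : Laurent k P} (hf : ExponentsGE a f)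
    (hg : ExponentsGE b g) : ExponentsGE (a + b) (f * g) := by
  classical
  intro y hy e
  obtain ⟨p, hp, q, hq, rfl⟩ := Finset.mem_add.1
    (support_coeff_mul_subset f g (Finsupp.mem_support_iff.2 hy))
  rw [sigma_add]
  exact add_le_add (hf p (Finsupp.mem_support_iff.1 hp) e) (hg q (Finsupp.mem_support_iff.1 hq) e)

theorem exponentsGE_single {a : HEdge P → ℤ} {x : WithBot P → ℤ} (c : k)
    (hx : ∀ e, a e ≤ sigma x e) : ExponentsGE a (single x c : Laurent k P) := by
  classical
  intro y hy
  have : x = y := by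
    by_contra hne
    exact hy (by rw [coeff_single, Finsupp.single_apply, if_neg hne])
  exact this ▸ hx

theorem exponentsGE_of_mem_hibiRing {f : Laurent k P} (hf : f ∈ hibiRing k P) :
    ExponentsGE 0 f := by
  induction hf using Algebra.adjoin_induction with
  | mem f hf =>
    obtain ⟨I, rfl⟩ := hf
    exact exponentsGE_single 1 (sigma_idealExponent_nonneg I)
  | algebraMap c => exact exponentsGE_single c fun e => by rw [sigma_zero]; rfl
  | add f g _ _ hf hg => exact hf.add hg
  | mul f g _ _ hf hg => simpa using hf.mul hg

/-- Multiplying by elements of k[P], whose exponents have σ ≥ 0, keeps the inequalities. -/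
theorem exponentsGE_of_mem_divIdeal {a : HEdge P → ℤ} {f : Laurent k P} (hf : f ∈ divIdeal k a) :
    ExponentsGE a f := by
  induction hf using Submodule.span_induction with
  | mem f hf =>
    obtain ⟨x, hx, rfl⟩ := hf
    exact exponentsGE_single 1 hx
  | zero => exact fun y hy => absurd rfl hy
  | add f g _ _ hf hg => exact hf.add hg
  | smul r f _ hf =>
    have := (exponentsGE_of_mem_hibiRing r.2).mul hf
    rw [zero_add] at this
    exact this

theorem single_mem_divIdeal {a : HEdge P → ℤ} {x : WithBot P → ℤ} (hx : ∀ e, a e ≤ sigma x e) :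
    (single x 1 : Laurent k P) ∈ divIdeal k a :=
  Submodule.subset_span ⟨x, hx, rfl⟩

/-- Every exponent vector is a difference of exponent vectors of monomials in the Hibi ring. -/
theorem exists_sub_of_hibiRing [Finite P] (x : WithBot P → ℤ) :
    ∃ y y' : WithBot P → ℤ, (single y 1 : Laurent k P) ∈ hibiRing k P ∧
      (single y' 1 : Laurent k P) ∈ hibiRing k P ∧ y - y' = x := by
  classical
  have : Finite (WithBot P) := inferInstanceAs (Finite (Option P))
  have := Fintype.ofFinite (WithBot P)
  have hadd : ∀ y y', (single y 1 : Laurent k P) ∈ hibiRing k P →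
      (single y' 1 : Laurent k P) ∈ hibiRing k P →
      (single (y + y') 1 : Laurent k P) ∈ hibiRing k P := by
    intro y y' h h'
    have := mul_mem h h'
    rwa [single_mul_single, one_mul] at this
  have hzero : (single 0 1 : Laurent k P) ∈ hibiRing k P := one_mem _
  let D : AddSubgroup (WithBot P → ℤ) :=
    { carrier := {x | ∃ y y' : WithBot P → ℤ, (single y 1 : Laurent k P) ∈ hibiRing k P ∧
        (single y' 1 : Laurent k P) ∈ hibiRing k P ∧ y - y' = x}
      zero_mem' := ⟨0, 0, hzero, hzero, sub_self 0⟩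
      add_mem' := by
        rintro _ _ ⟨y, y', h, h', rfl⟩ ⟨z, z', i, i', rfl⟩
        exact ⟨y + z, y' + z', hadd _ _ h i, hadd _ _ h' i', by abel⟩
      neg_mem' := by
        rintro _ ⟨y, y', h, h', rfl⟩
        exact ⟨y', y, h', h, by abel⟩ }
  have hI : ∀ I : LowerSet P, idealExponent I ∈ D := fun I =>
    ⟨idealExponent I, 0, Algebra.subset_adjoin ⟨I, rfl⟩, hzero, sub_zero _⟩
  -- The empty ideal gives t_⊥, and t_p is the quotient of the generators for the ideals `Iic p` and
  -- `Iio p`.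
  have hsingle : ∀ p, (Pi.single p 1 : WithBot P → ℤ) ∈ D := by
    intro p
    cases p with
    | bot =>
      convert hI ⊥
      ext q
      cases q <;> simp [idealExponent]
    | coe p =>
      convert D.sub_mem (hI (LowerSet.Iic p)) (hI (LowerSet.Iio p))
      ext q
      cases q with
      | bot => simp [idealExponent]
      | coe q =>
        simp only [Pi.sub_apply, idealExponent, WithBot.recBotCoe_coe, LowerSet.mem_Iic_iff,
          LowerSet.mem_Iio_iff, Pi.single_apply, WithBot.coe_inj]
        by_cases h : q = p
        · simp [h]
        · simp [h, lt_iff_le_and_ne]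
  have hx : x ∈ D := by
    rw [← Finset.univ_sum_single x]
    refine D.sum_mem fun p _ => ?_
    have := D.zsmul_mem (hsingle p) (x p)
    rwa [← Pi.single_smul, smul_eq_mul, mul_one] at this
  exact hx

theorem smul_map_eq_smul_map {R M N : Type*} [Semiring R] [AddCommMonoid M] [Module R M]
    [AddCommMonoid N] [Module R N] {S : Submodule R M} (φ : S →ₗ[R] N) {r s : R} {x y : M}
    (hx : x ∈ S) (hy : y ∈ S) (h : r • x = s • y) : r • φ ⟨x, hx⟩ = s • φ ⟨y, hy⟩ := by
  rw [← map_smul, ← map_smul]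
  exact congrArg φ (Subtype.ext h)

/-- A linear map from a divisorial ideal to the Laurent polynomials is multiplication by a
Laurent polynomial. -/
theorem exists_forall_eq_mul [Finite P] {a : HEdge P → ℤ}
    (φ : divIdeal k a →ₗ[hibiRing k P] Laurent k P) :
    ∃ f : Laurent k P, ∀ m, φ m = f * m := by
  obtain ⟨u, hu⟩ := exists_le_sigma a
  refine ⟨single (-u) 1 * φ ⟨single u 1, single_mem_divIdeal hu⟩, ?_⟩
  rintro ⟨m, hm⟩
  induction hm using Submodule.span_induction with
  | mem m hm =>
    obtain ⟨x, hx, rfl⟩ := hm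
    -- Now t^y' · t^x = t^y · t^u with both factors in k[P]; apply `φ` and cancel t^y' in L.
    obtain ⟨y, y', hy, hy', hyx⟩ := exists_sub_of_hibiRing (k := k) (x - u)
    have h2 := smul_map_eq_smul_map φ (r := ⟨_, hy'⟩) (s := ⟨_, hy⟩)
      (single_mem_divIdeal hx) (single_mem_divIdeal hu) (by
        change (single y' 1 : Laurent k P) * single x 1 = single y 1 * single u 1
        rw [single_mul_single, single_mul_single, sub_eq_sub_iff_add_eq_add.1 hyx,
          add_comm y' x])
    change (single y' 1 : Laurent k P) * φ _ = single y 1 * φ _ at h2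
    have h3 := congrArg (fun m => (single (-y') 1 : Laurent k P) * m) h2
    simp only [← mul_assoc, single_mul_single, neg_add_cancel, one_mul] at h3
    rw [← one_def, one_mul] at h3
    change φ ⟨single x 1, single_mem_divIdeal hx⟩ = _
    rw [h3, mul_right_comm, single_mul_single, one_mul]
    congr 2
    rw [neg_add_eq_sub, neg_add_eq_sub, hyx]
  | zero => exact (map_zero φ).trans (mul_zero _).symm
  | add m n hm hn ihm ihn =>
    have := map_add φ ⟨m, hm⟩ ⟨n, hn⟩
    rw [ihm, ihn, ← mul_add] at this
    exact this
  | smul r m hm ih =>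
    have := φ.map_smul r ⟨m, hm⟩
    rw [ih] at this
    exact this.trans (mul_left_comm (r : Laurent k P) _ m)

/-- Multiplication by a monomial. -/
def monomialEquiv (w : WithBot P → ℤ) : Laurent k P ≃ₗ[hibiRing k P] Laurent k P where
  toFun m := single w 1 * m
  map_add' m n := mul_add _ m n
  map_smul' r m := mul_left_comm _ (r : Laurent k P) m
  invFun m := single (-w) 1 * m
  left_inv m := by
    beta_reduce
    rw [← mul_assoc, single_mul_single, neg_add_cancel, one_mul, ← one_def, one_mul]
  right_inv m := by
    beta_reduce
    rw [← mul_assoc, single_mul_single, add_neg_cancel, one_mul, ← one_def, one_mul]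

theorem map_monomialEquiv_divIdeal (a : HEdge P → ℤ) (w : WithBot P → ℤ) :
    (divIdeal k a).map (monomialEquiv (k := k) w).toLinearMap =
      divIdeal k (fun e => a e + sigma w e) := by
  rw [divIdeal, Submodule.map_span]
  congr 1
  ext m
  constructor
  · rintro ⟨_, ⟨x, hx, rfl⟩, rfl⟩
    refine ⟨w + x, fun e => ?_, ?_⟩
    · rw [sigma_add, add_comm]
      exact add_le_add (hx e) le_rfl
    · change (single w 1 : Laurent k P) * single x 1 = _
      rw [single_mul_single, one_mul]
  · rintro ⟨x, hx, rfl⟩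
    refine ⟨single (x - w) 1, ⟨x - w, fun e => ?_, rfl⟩, ?_⟩
    · rw [sigma_sub]
      have := hx e
      linarith
    · change (single w 1 : Laurent k P) * single (x - w) 1 = _
      rw [single_mul_single, one_mul, add_sub_cancel]

/-- Divisorial ideals are isomorphic if and only if their defining vectors differ by an element
of the image of `σ`. -/
theorem isoClass_divIdeal_eq_iff [Finite P] (a b : HEdge P → ℤ) :
    isoClass (divIdeal k a) = isoClass (divIdeal k b) ↔
      ∃ w : WithBot P → ℤ, ∀ e, b e = a e + sigma w e := by
  constructor
  · intro h
    obtain ⟨φ⟩ : Nonempty (divIdeal k a ≃ₗ[hibiRing k P] divIdeal k b) := Quotient.exact h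
    obtain ⟨f, hf⟩ := exists_forall_eq_mul ((divIdeal k b).subtype ∘ₗ φ.toLinearMap)
    obtain ⟨g, hg⟩ := exists_forall_eq_mul ((divIdeal k a).subtype ∘ₗ φ.symm.toLinearMap)
    replace hf : ∀ m, (φ m : Laurent k P) = f * m := hf
    replace hg : ∀ m, (φ.symm m : Laurent k P) = g * m := hg
    have hfg : f * g = 1 := by
      obtain ⟨u, hu⟩ := exists_le_sigma a
      have h1 := hg (φ ⟨single u 1, single_mem_divIdeal hu⟩)
      rw [hf, φ.symm_apply_apply] at h1
      have h2 := congrArg (fun m => m * (single (-u) 1 : Laurent k P)) h1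
      simp only [mul_assoc, single_mul_single, add_neg_cancel, one_mul] at h2
      rw [← one_def, mul_one] at h2
      rw [mul_comm, h2]
    have : Finite (WithBot P) := inferInstanceAs (Finite (Option P))
    obtain ⟨w, c, d, hc, hd, rfl, rfl⟩ := exists_single_of_mul_eq_one hfg
    -- Test on a monomial t^x of T(a) with σ_e(x) = a_e: its image lies in T(b), so b_e ≤ a_e +
    -- σ_e(w). The inverse gives the opposite inequality.
    have hshift : ∀ {a b : HEdge P → ℤ} {w : WithBot P → ℤ} {c : k}, c ≠ 0 →
        (∀ m : divIdeal k a, (single w c : Laurent k P) * m ∈ divIdeal k b) →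
        ∀ e, b e ≤ a e + sigma w e := by
      intro a b w c hc h e
      obtain ⟨x, hxe, hx⟩ := exists_sigma_eq_and_le a e
      have h1 := exponentsGE_of_mem_divIdeal (h ⟨single x 1, single_mem_divIdeal hx⟩) (w + x)
        (by rw [single_mul_single, mul_one, coeff_single, Finsupp.single_eq_same]; exact hc) e
      rw [sigma_add, hxe, add_comm] at h1
      exact h1
    refine ⟨w, fun e => le_antisymm (hshift hc (fun m => hf m ▸ (φ m).2) e) ?_⟩
    have := hshift hd (fun m => hg m ▸ (φ.symm m).2) e
    rw [sigma_neg] at this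
    linarith
  · rintro ⟨w, hw⟩
    have hb : b = fun e => a e + sigma w e := funext hw
    rw [hb, ← map_monomialEquiv_divIdeal]
    exact Quotient.sound ⟨(monomialEquiv w).submoduleMap (divIdeal k a)⟩

end Ideals

/-! ### Normal forms along the spanning tree -/

section Tree

open SimpleGraph

variable {P : Type v} [PartialOrder P] {T : SimpleGraph (Hat P)}

/-- Every integer vector on the edges is congruent, modulo the image of `σ`, to one that vanishes
on the spanning tree. -/
theorem exists_eq_cotreeExtend_add_sigma (hTree : T.IsTree)
    (a : HEdge P → ℤ) :
    ∃ (z : Cotree T → ℤ) (w : WithBot P → ℤ), ∀ e, a e = cotreeExtend T z e + sigma w e := by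
  -- Subtracting the coboundary of this integral potential kills `a` on the tree.
  obtain ⟨F, hF⟩ := exists_potential_of_isTree hTree (stepVal a) (stepVal_antisymm a)
  refine ⟨fun e => a e.1 - (F e.1.1.1 - F e.1.1.2), fun p => F p - F ⊤, fun e => ?_⟩
  rw [sigma_restrict]
  by_cases h : T.Adj e.1.1 e.1.2
  · rw [cotreeExtend_of_adj _ h, hF _ _ h, stepVal_up a e.2, zero_add]
  · have := cotreeExtend_coe (fun e : Cotree T => a e.1 - (F e.1.1.1 - F e.1.1.2)) ⟨e, h⟩
    rw [this, sub_add_cancel]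

/-- σ(w) vanishes on the tree, so `w` extended by 0 is constant on the connected vertex set and σ(w)
vanishes everywhere. -/
theorem eq_of_cotreeExtend_eq_add_sigma (hT : T ≤ hasse (Hat P)) (hTree : T.IsTree)
    {z z' : Cotree T → ℤ} {w : WithBot P → ℤ}
    (h : ∀ e, cotreeExtend T z' e = cotreeExtend T z e + sigma w e) : z = z' := by
  have hstep : ∀ {u v : Hat P}, T.Adj u v → extendTop w u = extendTop w v := by
    intro u v huv
    rcases hT huv with h' | h'
    · have := h ⟨(u, v), h'⟩
      rw [cotreeExtend_of_adj _ huv, cotreeExtend_of_adj _ huv, zero_add] at this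
      exact sub_eq_zero.1 this.symm
    · have := h ⟨(v, u), h'⟩
      rw [cotreeExtend_of_adj _ huv.symm, cotreeExtend_of_adj _ huv.symm, zero_add] at this
      exact (sub_eq_zero.1 this.symm).symm
  have hwalk : ∀ {u v : Hat P}, T.Walk u v → extendTop w u = extendTop w v := by
    intro u v p
    induction p with
    | nil => rfl
    | cons h p ih => exact (hstep h).trans ih
  funext e
  obtain ⟨p⟩ := hTree.connected.preconnected e.1.1.1 e.1.1.2
  have := h e.1
  rw [cotreeExtend_coe, cotreeExtend_coe, sigma, hwalk p, sub_self, add_zero] at this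
  exact this.symm

theorem card_cotree_add [Finite P] (hT : T ≤ hasse (Hat P)) (hTree : T.IsTree) {d n : ℕ}
    (hd : Nat.card (Hat P) = d + 1) (hn : Nat.card (hasse (Hat P)).edgeSet = n) :
    Nat.card (Cotree T) + d = n := by
  classical
  have : Finite (Hat P) := inferInstanceAs (Finite (Option (Option P)))
  have := Fintype.ofFinite (Hat P)
  have hTd : T.edgeSet.ncard = d := by
    have h := hTree.card_edgeFinset
    rw [← Nat.card_eq_fintype_card, hd, ← Set.ncard_coe_finset, coe_edgeFinset] at h
    omega
  let φ : Cotree T → ((hasse (Hat P)).edgeSet \ T.edgeSet : Set (Sym2 (Hat P))) := fun e =>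
    ⟨s(e.1.1.1, e.1.1.2), Or.inl e.1.2, e.2⟩
  have hφ : Function.Bijective φ := by
    constructor
    · rintro ⟨⟨⟨p, q⟩, hpq⟩, he⟩ ⟨⟨⟨p', q'⟩, hpq'⟩, he'⟩ heq
      have h := congrArg Subtype.val heq
      change s(p, q) = s(p', q') at h
      rw [Sym2.eq_iff] at h
      rcases h with ⟨rfl, rfl⟩ | ⟨rfl, rfl⟩
      · rfl
      · exact absurd hpq' (not_covBy_symm hpq)
    · rintro ⟨e, he, he'⟩
      induction e using Sym2.ind with
      | _ p q =>
      rcases he with h | h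
      · exact ⟨⟨⟨(p, q), h⟩, he'⟩, rfl⟩
      · exact ⟨⟨⟨(q, p), h⟩, fun hadj => he' hadj.symm⟩, Subtype.ext Sym2.eq_swap⟩
  rw [Nat.card_eq_of_bijective φ hφ, ← hn, Nat.card_coe_set_eq, Nat.card_coe_set_eq, ← hTd]
  exact Set.ncard_sdiff_add_ncard_of_subset (edgeSet_mono hT)

end Tree

end HibiConic
end

/-! ### Assembly of the theorem -/

theorem theorem3p4 {k : Type u} [Field k] {P : Type v} [PartialOrder P] [Finite P] (d n : ℕ)
    (hd : Nat.card (HibiConic.Hat P) = d + 1)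
    (hn : Nat.card (SimpleGraph.hasse (HibiConic.Hat P)).edgeSet = n)
    (T : SimpleGraph (HibiConic.Hat P)) (hT : T ≤ SimpleGraph.hasse (HibiConic.Hat P))
    (hTree : T.IsTree) :
    Nat.card (HibiConic.Cotree T) + d = n ∧
    Bornology.IsBounded (HibiConic.polytope T) ∧
    Set.BijOn
      (fun z : HibiConic.Cotree T → ℤ =>
        HibiConic.isoClass (HibiConic.divIdeal k (HibiConic.extendZero T z)))
      Set.univ (HibiConic.divisorialClasses k P) ∧
    Set.BijOn
      (fun z : HibiConic.Cotree T → ℤ =>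
        HibiConic.isoClass (HibiConic.divIdeal k (HibiConic.extendZero T z)))
      {z | (fun e => (z e : ℝ)) ∈ HibiConic.polytope T} (HibiConic.conicClasses k P) := by
  open HibiConic in
  have hinj : Function.Injective fun z : Cotree T → ℤ =>
      isoClass (divIdeal k (extendZero T z)) := by
    intro z z' h
    obtain ⟨w, hw⟩ := (isoClass_divIdeal_eq_iff _ _).1 h
    -- `extendZero` unfolds to `cotreeExtend` over the integers.
    exact eq_of_cotreeExtend_eq_add_sigma hT hTree hw
  refine ⟨card_cotree_add hT hTree hd hn, isBounded_polytope hT hTree,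
    ⟨fun z _ => ⟨_, rfl⟩, hinj.injOn, ?_⟩, ⟨?_, hinj.injOn, ?_⟩⟩
  · rintro _ ⟨a, rfl⟩
    obtain ⟨z, w, hzw⟩ := exists_eq_cotreeExtend_add_sigma hTree a
    exact ⟨z, trivial, (isoClass_divIdeal_eq_iff _ _).2 ⟨w, hzw⟩⟩
  · intro z hz
    obtain ⟨x, hx⟩ := exists_ceil_sigma_eq hT hTree hz
    exact ⟨_, ⟨x, congrArg (divIdeal k) (funext hx)⟩, rfl⟩
  · rintro _ ⟨_, ⟨x, rfl⟩, rfl⟩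
    obtain ⟨z, w, hzw⟩ := exists_eq_cotreeExtend_add_sigma hTree fun e => ⌈sigma x e⌉
    -- Shifting `x` by the integral vector `w` commutes with the ceiling, so x - w rounds up to the
    -- representative vanishing on the tree.
    refine ⟨z, mem_polytope_of_ceil_sigma (x := x - fun p => (w p : ℝ)) fun e => ?_,
      (isoClass_divIdeal_eq_iff _ _).2 ⟨w, hzw⟩⟩
    rw [sigma_sub, sigma_intCast, Int.ceil_sub_intCast, hzw, add_sub_cancel_right]
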